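/- Define $u(n)$ for $n\ge 0$ by $$u(n)=\prod_{i=1}^{n}(4i-1)^2-\sum_{m=0}^{n-1}\binom{2n+1}{2m+1}\Big(\prod_{i=1}^{n-m}(4i-3)^2\Big)u(m)$$ (so $u(0)=1$), define $v(n)$ by $v(0)=1$ and, for $n\ge 1$, $$v(n)=2^{n-1}\prod_{i=1}^{n}(4i-3)^2-\frac12\sum_{m=1}^{n-1}\binom{2n}{2m}v(m)v(n-m),$$ put $$s(n,k)=\frac{(2n)!}{(2k)!}\,[z^{2n}]\Big(\sum_{j\ge 0}\frac{u(j)}{(2j+1)!}z^{2j+1}\Big)^{2k},$$ where $[z^{2n}]$ denotes the coefficient of $z^{2n}$, and define, for $n\ge 0$, $$d(n)=v(n)-\sum_{k=1}^{n-1}2^{n-k}s(n,k)d(k).$$ (These $d(n)$ are Romik's normalized Taylor coefficients of the Jacobi theta function $\theta_3$ at $1$.) Then every $d(n)$ is an integer, and for every prime $p\equiv 1\pmod 4$ and every $n\ge 1$, $$d\left(n+\frac{(p-1)^2}{2}\right)\equiv d(n)\pmod p.$$ That is, the sequence $(d(n))_{n\ge 1}$ modulo $p$ is periodic, and $\frac{(p-1)^2}{2}$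 is a (not necessarily minimal) period. -/

import Mathlib

/-- The integers `u(n)`, given by
`u(n) = 3² 7² ⋯ (4n-1)² - ∑_{m=0}^{n-1} C(2n+1, 2m+1) 1² 5² ⋯ (4(n-m)-3)² u(m)`;
for `n = 0` this reads `u(0) = 1`. -/
def romikU (n : ℕ) : ℤ :=
  (∏ i ∈ Finset.range n, (4 * (i : ℤ) + 3) ^ 2) -
    ∑ m ∈ (Finset.range n).attach,
      (Nat.choose (2 * n + 1) (2 * m.1 + 1) : ℤ) *
        (∏ i ∈ Finset.range (n - m.1), (4 * (i : ℤ) + 1) ^ 2) * romikU m.1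
termination_by n
decreasing_by exact Finset.mem_range.mp m.2

/-- The numbers `v(n)`, given by `v(0) = 1` and, for `n ≥ 1`,
`v(n) = 2^(n-1) 1² 5² ⋯ (4n-3)² - (1/2) ∑_{m=1}^{n-1} C(2n, 2m) v(m) v(n-m)`. -/
def romikV (n : ℕ) : ℚ :=
  if n = 0 then 1 else
    2 ^ (n - 1) * (∏ i ∈ Finset.range n, (4 * (i : ℚ) + 1) ^ 2) -
      1 / 2 * ∑ m ∈ (Finset.Ico 1 n).attach,
        (Nat.choose (2 * n) (2 * m.1) : ℚ) * romikV m.1 * romikV (n - m.1)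
termination_by n
decreasing_by
  · exact (Finset.mem_Ico.mp m.2).2
  · have h := Finset.mem_Ico.mp m.2
    omega

/-- The formal power series `∑_{j ≥ 0} u(j) / (2j+1)! z^(2j+1)`. -/
noncomputable def romikUSeries : PowerSeries ℚ :=
  PowerSeries.mk fun i =>
    if i % 2 = 1 then (romikU (i / 2) : ℚ) / (Nat.factorial i : ℚ) else 0

/-- `s(n,k) = (2n)! / (2k)! · [z^(2n)] (∑_{j ≥ 0} u(j) / (2j+1)! z^(2j+1))^(2k)`. -/
noncomputable def romikS (n k : ℕ) : ℚ :=
  (Nat.factorial (2 * n) : ℚ) / (Nat.factorial (2 * k) : ℚ) *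
    PowerSeries.coeff (2 * n) (romikUSeries ^ (2 * k))

/-- The coefficients `d(n) = v(n) - ∑_{k=1}^{n-1} 2^(n-k) s(n,k) d(k)`. -/
noncomputable def romikD (n : ℕ) : ℚ :=
  romikV n - ∑ k ∈ (Finset.Ico 1 n).attach, 2 ^ (n - k.1) * romikS n k.1 * romikD k.1
termination_by n
decreasing_by exact (Finset.mem_Ico.mp k.2).2

theorem romikU_eq (n : ℕ) :
    romikU n = (∏ i ∈ Finset.range n, (4 * (i : ℤ) + 3) ^ 2) -
      ∑ m ∈ Finset.range n, (Nat.choose (2 * n + 1) (2 * m + 1) : ℤ) *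
        (∏ i ∈ Finset.range (n - m), (4 * (i : ℤ) + 1) ^ 2) * romikU m := by
  rw [romikU, Finset.sum_attach (Finset.range n) fun m =>
    (Nat.choose (2 * n + 1) (2 * m + 1) : ℤ) *
      (∏ i ∈ Finset.range (n - m), (4 * (i : ℤ) + 1) ^ 2) * romikU m]

theorem romikV_zero : romikV 0 = 1 := by
  rw [romikV, if_pos rfl]

theorem romikV_eq (n : ℕ) (hn : 1 ≤ n) :
    romikV n = 2 ^ (n - 1) * (∏ i ∈ Finset.range n, (4 * (i : ℚ) + 1) ^ 2) -
      1 / 2 * ∑ m ∈ Finset.Ico 1 n,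
        (Nat.choose (2 * n) (2 * m) : ℚ) * romikV m * romikV (n - m) := by
  rw [romikV, if_neg (by omega), Finset.sum_attach (Finset.Ico 1 n) fun m =>
    (Nat.choose (2 * n) (2 * m) : ℚ) * romikV m * romikV (n - m)]

theorem romikD_eq (n : ℕ) :
    romikD n = romikV n - ∑ k ∈ Finset.Ico 1 n, 2 ^ (n - k) * romikS n k * romikD k := by
  rw [romikD, Finset.sum_attach (Finset.Ico 1 n) fun k =>
    2 ^ (n - k) * romikS n k * romikD k]

/-!
Write `A` and `B` for the odd and even solutions of `(1 - 8X²) x'' = 16 X x' + 2 x` with integral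
Hurwitz coefficients. The recurrences for `u` and `v` say that `w = ∑ 2ⁿ u(n) X²ⁿ⁺¹ / (2n+1)!` is
`A / B` and that `V = ∑ v(n) X²ⁿ / (2n)!` is a square root of `B`, while the recurrence for `d` says
that `V = ∑ d(n) w²ⁿ / (2n)!`. By the Wronskian identity `dX/dw` is the integral series
`f = (1 - 8X²) V⁴`, so `d(n)`, the constant term of `(f d/dX)²ⁿ V`, is an integer.

Modulo a prime `p ≡ 1 (mod 4)` the coefficients of `B` vanish from index `p` on. As `p`-th powers of
Hurwitz series are constant, `V = B ^ ((p + 1) / 2)`, so `V`, `f` and every `(f d/dX)ᵐ V` vanish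
from index `p` on as well. For such a series the `p`-th Taylor coefficient in `w` is `-w_p` times
the first one, whence `d(n + (p - 1) / 2) ≡ -w_p d(n)`. Finally `w_p ≡ A_p` is a unit, and Fermat's
little theorem applies after `p - 1` steps.
-/

/-- A Hurwitz series over `R`: the sequence `a` stands for the exponential generating function
`∑ aₙ Xⁿ / n!`. Recording the numerators `aₙ` makes the product and the derivative available over
every commutative ring, in particular over `ℤ` and in characteristic `p`. -/
def HurwitzSeries (R : Type*) : Type _ := ℕ → R

namespace HurwitzSeries

open Finset

noncomputable section

variable {R S K : Type*} [CommRing R] [CommRing S] [Field K]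

section Ring

instance : AddCommGroup (HurwitzSeries R) := inferInstanceAs (AddCommGroup (ℕ → R))

instance : Module R (HurwitzSeries R) := inferInstanceAs (Module R (ℕ → R))

/-- The Hurwitz series `∑ aₙ Xⁿ / n!`. -/
def mk (a : ℕ → R) : HurwitzSeries R := a

/-- The coefficient of `Xⁿ / n!`. -/
def coeff (n : ℕ) : HurwitzSeries R →ₗ[R] R := LinearMap.proj n

@[simp] theorem coeff_mk (n : ℕ) (a : ℕ → R) : coeff n (mk a) = a n := rfl

@[ext] theorem ext {a b : HurwitzSeries R} (h : ∀ n, coeff n a = coeff n b) : a = b := funext h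

/-- The left shift of sequences, which differentiates exponential generating functions; it becomes
`derivative` once the ring structure is in place. -/
def shift : HurwitzSeries R →ₗ[R] HurwitzSeries R := LinearMap.funLeft R R Nat.succ

theorem coeff_shift (n : ℕ) (a : HurwitzSeries R) : coeff n (shift a) = coeff (n + 1) a := rfl

instance : Mul (HurwitzSeries R) where
  mul a b := mk fun n => ∑ ij ∈ antidiagonal n, n.choose ij.1 * (coeff ij.1 a * coeff ij.2 b)

instance : One (HurwitzSeries R) where
  one := mk fun n => if n = 0 then 1 else 0

theorem coeff_mul (n : ℕ) (a b : HurwitzSeries R) :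
    coeff n (a * b) = ∑ ij ∈ antidiagonal n, n.choose ij.1 * (coeff ij.1 a * coeff ij.2 b) := rfl

theorem coeff_one (n : ℕ) : coeff n (1 : HurwitzSeries R) = if n = 0 then 1 else 0 := rfl

@[simp] theorem coeff_zero_one : coeff 0 (1 : HurwitzSeries R) = 1 := rfl

@[simp] theorem coeff_zero_mul (a b : HurwitzSeries R) :
    coeff 0 (a * b) = coeff 0 a * coeff 0 b := by
  simp [coeff_mul]

theorem shift_one : shift (1 : HurwitzSeries R) = 0 := by
  ext n
  simp [coeff_shift, coeff_one]

theorem shift_mul (a b : HurwitzSeries R) : shift (a * b) = a * shift b + shift a * b := by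
  ext n
  simp only [coeff_shift, map_add, coeff_mul]
  rw [sum_antidiagonal_choose_succ_mul fun i j => coeff i a * coeff j b]
  congr 1
  refine sum_congr rfl fun ij hij => ?_
  rw [Nat.choose_symm_of_eq_add (mem_antidiagonal.mp hij).symm]

private theorem mul_add' (a b c : HurwitzSeries R) : a * (b + c) = a * b + a * c := by
  ext n
  simp only [coeff_mul, map_add, mul_add, sum_add_distrib]

private theorem add_mul' (a b c : HurwitzSeries R) : (a + b) * c = a * c + b * c := by
  ext n
  simp only [coeff_mul, map_add, mul_add, add_mul, sum_add_distrib]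

private theorem mul_comm' (a b : HurwitzSeries R) : a * b = b * a := by
  ext n
  induction n generalizing a b with
  | zero => simp [mul_comm]
  | succ n ih => rw [← coeff_shift, ← coeff_shift, shift_mul, shift_mul, map_add, map_add,
      ih a, ih (shift a), add_comm]

private theorem one_mul' (a : HurwitzSeries R) : 1 * a = a := by
  ext n
  induction n generalizing a with
  | zero => simp
  | succ n ih =>
    have hzero : coeff n (0 * a) = 0 := by simp [coeff_mul]
    rw [← coeff_shift, shift_mul, shift_one, map_add, ih, hzero, add_zero,
      coeff_shift]

private theorem mul_assoc' (a b c : HurwitzSeries R) : a * b * c = a * (b * c) := by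
  ext n
  induction n generalizing a b c with
  | zero => simp [mul_assoc]
  | succ n ih =>
    simp only [← coeff_shift, shift_mul, mul_add', add_mul', map_add, ih, add_assoc]

instance : CommRing (HurwitzSeries R) where
  __ := (inferInstance : AddCommGroup (HurwitzSeries R))
  mul_assoc := mul_assoc'
  one_mul := one_mul'
  mul_one a := (mul_comm' a 1).trans (one_mul' a)
  left_distrib := mul_add'
  right_distrib := add_mul'
  zero_mul a := by ext n; simp [coeff_mul]
  mul_zero a := by ext n; simp [coeff_mul]
  mul_comm := mul_comm'

instance : Algebra R (HurwitzSeries R) :=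
  Algebra.ofModule
    (fun r a b => by ext n; simp only [coeff_mul, map_smul, smul_eq_mul, mul_sum, mul_left_comm,
      mul_assoc])
    (fun r a b => by ext n; simp only [coeff_mul, map_smul, smul_eq_mul, mul_sum, mul_left_comm])

@[simp] theorem coeff_zero_pow (a : HurwitzSeries R) (k : ℕ) :
    coeff 0 (a ^ k) = coeff 0 a ^ k := by
  induction k with
  | zero => simp
  | succ k ih => rw [pow_succ, coeff_zero_mul, ih, pow_succ]

@[simp] theorem coeff_zero_algebraMap (r : R) :
    coeff 0 (algebraMap R (HurwitzSeries R) r) = r := by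
  simp [Algebra.algebraMap_eq_smul_one]

end Ring

section Derivative

/-- The derivative `∑ aₙ₊₁ Xⁿ / n!`. -/
def derivative : Derivation R (HurwitzSeries R) (HurwitzSeries R) :=
  Derivation.mk' shift fun a b => by
    rw [shift_mul, smul_eq_mul, smul_eq_mul, mul_comm b]

@[simp] theorem coeff_derivative (n : ℕ) (a : HurwitzSeries R) :
    coeff n (derivative a) = coeff (n + 1) a := rfl

theorem ext_derivative {a b : HurwitzSeries R} (h₀ : coeff 0 a = coeff 0 b)
    (h : derivative a = derivative b) : a = b := by
  ext n
  cases n with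
  | zero => exact h₀
  | succ n => rw [← coeff_derivative, h, coeff_derivative]

theorem eq_algebraMap_of_derivative_eq_zero {a : HurwitzSeries R} (h : derivative a = 0) :
    a = algebraMap R _ (coeff 0 a) :=
  ext_derivative (coeff_zero_algebraMap _).symm (h.trans (derivative.map_algebraMap _).symm)

/-- The series `X`. -/
def X : HurwitzSeries R := mk fun n => if n = 1 then 1 else 0

@[simp] theorem coeff_zero_X : coeff 0 (X : HurwitzSeries R) = 0 := rfl

theorem coeff_X_of_ne_one {n : ℕ} (hn : n ≠ 1) : coeff n (X : HurwitzSeries R) = 0 := if_neg hn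

@[simp] theorem derivative_X : derivative (X : HurwitzSeries R) = 1 := by
  ext n
  simp [X, coeff_one]

theorem coeff_succ_X_mul (n : ℕ) (a : HurwitzSeries R) :
    coeff (n + 1) (X * a) = (n + 1) * coeff n a := by
  induction n generalizing a with
  | zero => simp [← coeff_derivative]
  | succ n ih =>
    rw [← coeff_derivative, Derivation.leibniz, derivative_X, smul_eq_mul, smul_eq_mul, mul_one,
      map_add, ih, coeff_derivative]
    push_cast
    ring

theorem coeff_X_mul_derivative (n : ℕ) (a : HurwitzSeries R) :
    coeff n (X * derivative a) = n * coeff n a := by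
  cases n with
  | zero => simp
  | succ n => rw [coeff_succ_X_mul, coeff_derivative, Nat.cast_succ]

end Derivative

section Map

/-- Coefficientwise application of a ring homomorphism. -/
def map (φ : R →+* S) : HurwitzSeries R →+* HurwitzSeries S where
  toFun a := mk fun n => φ (coeff n a)
  map_one' := by ext n; simp [coeff_one, apply_ite φ]
  map_mul' a b := by ext n; simp [coeff_mul]
  map_zero' := by ext n; simp
  map_add' a b := by ext n; simp

@[simp] theorem coeff_map (φ : R →+* S) (n : ℕ) (a : HurwitzSeries R) :
    coeff n (map φ a) = φ (coeff n a) := rfl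

theorem map_derivative (φ : R →+* S) (a : HurwitzSeries R) :
    map φ (derivative a) = derivative (map φ a) := rfl

theorem map_injective {φ : R →+* S} (hφ : Function.Injective φ) : Function.Injective (map φ) :=
  fun a b h => ext fun n => hφ <| by rw [← coeff_map, h, coeff_map]

@[simp] theorem map_X (φ : R →+* S) : map φ X = X := by
  ext n
  simp [X, apply_ite φ]

end Map

section CharP

variable {p : ℕ} [CharP R p]

theorem pow_char (a : HurwitzSeries R) : a ^ p = algebraMap R _ (coeff 0 a ^ p) := by
  have hp : derivative (a ^ p) = 0 := by
    rw [Derivation.leibniz_pow, ← Nat.cast_smul_eq_nsmul R, CharP.cast_eq_zero, zero_smul]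
  rw [eq_algebraMap_of_derivative_eq_zero hp, coeff_zero_pow]

variable [Fact p.Prime]

theorem coeff_prime_mul (a b : HurwitzSeries R) :
    coeff p (a * b) = coeff p a * coeff 0 b + coeff 0 a * coeff p b := by
  have hp : p.Prime := Fact.out
  rw [coeff_mul, sum_eq_add (p, 0) (0, p) (by simp [hp.ne_zero])]
  · simp
  · rintro ⟨i, j⟩ hij ⟨h₁, h₂⟩
    have hsum : i + j = p := mem_antidiagonal.mp hij
    have hdvd : p ∣ p.choose i := hp.dvd_choose_self (by grind) (by grind)
    rw [(CharP.cast_eq_zero_iff R p _).mpr hdvd, zero_mul]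
  · simp
  · simp

variable (R p) in
/-- The series in characteristic `p` whose coefficients vanish from `p` on. They form a subring
because `p` divides the binomial coefficients `C(n, i)` with `i, n - i < p ≤ n`. -/
def truncated : Subalgebra R (HurwitzSeries R) where
  carrier := {a : HurwitzSeries R | ∀ n, p ≤ n → coeff n a = 0}
  add_mem' {a b} ha hb n hn := by rw [map_add, ha n hn, hb n hn, add_zero]
  mul_mem' {a b} ha hb n hn := by
    rw [coeff_mul]
    refine sum_eq_zero fun ij hij => ?_
    have hsum : ij.1 + ij.2 = n := mem_antidiagonal.mp hij
    rcases le_or_gt p ij.1 with hi | hi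
    · rw [ha _ hi, zero_mul, mul_zero]
    rcases le_or_gt p ij.2 with hj | hj
    · rw [hb _ hj, mul_zero, mul_zero]
    have hdvd : p ∣ n.choose ij.1 :=
      hsum ▸ (Fact.out : p.Prime).dvd_choose_add hi hj (hsum ▸ hn)
    rw [(CharP.cast_eq_zero_iff R p _).mpr hdvd, zero_mul]
  algebraMap_mem' r n hn := by
    have hn₀ : n ≠ 0 := ((Fact.out : p.Prime).pos.trans_le hn).ne'
    simp [Algebra.algebraMap_eq_smul_one, coeff_one, hn₀]

theorem X_mem_truncated : X ∈ truncated R p := fun _ hn =>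
  coeff_X_of_ne_one ((Fact.out : p.Prime).one_lt.trans_le hn).ne'

theorem derivative_mem_truncated {a : HurwitzSeries R} (ha : a ∈ truncated R p) :
    derivative a ∈ truncated R p := fun n hn => ha (n + 1) (by omega)

end CharP

theorem coeff_mul_of_forall_lt_eq_zero {m : ℕ} (a : HurwitzSeries R) {b : HurwitzSeries R}
    (hb : ∀ i < m, coeff i b = 0) : coeff m (a * b) = coeff 0 a * coeff m b := by
  rw [coeff_mul, sum_eq_single (0, m)]
  · simp
  · rintro ⟨i, j⟩ hij hne
    have hsum : i + j = m := mem_antidiagonal.mp hij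
    rw [hb j (by grind), mul_zero, mul_zero]
  · simp

theorem coeff_X_pow (n k : ℕ) :
    coeff n (X ^ k : HurwitzSeries R) = if n = k then (k.factorial : R) else 0 := by
  induction k generalizing n with
  | zero => simp [coeff_one]
  | succ k ih =>
    cases n with
    | zero => simp
    | succ n =>
      rw [pow_succ', coeff_succ_X_mul, ih]
      by_cases h : n = k <;> simp [h, Nat.factorial_succ]

section ChangeVar

/-- The derivation `f d/dX`; it is `d/dw` for a coordinate `w` with `dX/dw = f`. -/
def derivativeAlong (f : HurwitzSeries R) : Derivation R (HurwitzSeries R) (HurwitzSeries R) :=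
  f • derivative

/-- The map underlying `changeVar`. -/
def changeVarLinear (f : HurwitzSeries R) : HurwitzSeries R →ₗ[R] HurwitzSeries R where
  toFun a := mk fun n => coeff 0 (((derivativeAlong f).toLinearMap ^ n) a)
  map_add' a b := by ext n; simp
  map_smul' r a := by ext n; simp

theorem coeff_changeVarLinear_succ (f : HurwitzSeries R) (n : ℕ) (a : HurwitzSeries R) :
    coeff (n + 1) (changeVarLinear f a) = coeff n (changeVarLinear f (f * derivative a)) := rfl

theorem changeVarLinear_mul (f a b : HurwitzSeries R) :
    changeVarLinear f (a * b) = changeVarLinear f a * changeVarLinear f b := by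
  have hder (c : HurwitzSeries R) :
      derivative (changeVarLinear f c) = changeVarLinear f (f * derivative c) := rfl
  ext n
  induction n generalizing a b with
  | zero => exact (coeff_zero_mul a b).trans (coeff_zero_mul _ _).symm
  | succ n ih =>
    have hleibniz : f * derivative (a * b) = a * (f * derivative b) + f * derivative a * b := by
      rw [Derivation.leibniz, smul_eq_mul, smul_eq_mul]
      ring
    rw [coeff_changeVarLinear_succ, hleibniz, map_add, map_add, ih, ih, ← hder, ← hder,
      ← coeff_derivative, Derivation.leibniz, map_add, smul_eq_mul, smul_eq_mul,
      mul_comm (derivative _)]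

/-- The algebra endomorphism that rewrites a series in the coordinate `w` with `dX/dw = f`: as
`d/dw = f d/dX`, the `n`-th Taylor coefficient of `a` with respect to `w` is the constant term of
`(f d/dX)ⁿ a`. -/
def changeVar (f : HurwitzSeries R) : HurwitzSeries R →ₐ[R] HurwitzSeries R :=
  AlgHom.ofLinearMap (changeVarLinear f)
    (ext_derivative rfl <| by
      rw [Derivation.map_one_eq_zero]
      change changeVarLinear f (f * derivative 1) = 0
      rw [Derivation.map_one_eq_zero, mul_zero, map_zero])
    (changeVarLinear_mul f)

variable (f : HurwitzSeries R)

theorem coeff_add_changeVar (m n : ℕ) (a : HurwitzSeries R) : coeff (m + n) (changeVar f a) =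
    coeff n (changeVar f (((derivativeAlong f).toLinearMap ^ m) a)) := by
  change coeff 0 (((derivativeAlong f).toLinearMap ^ (m + n)) a) =
    coeff 0 (((derivativeAlong f).toLinearMap ^ n) _)
  rw [add_comm, pow_add, Module.End.mul_apply]

@[simp] theorem coeff_zero_changeVar (a : HurwitzSeries R) :
    coeff 0 (changeVar f a) = coeff 0 a := rfl

theorem derivative_changeVar (a : HurwitzSeries R) :
    derivative (changeVar f a) = changeVar f (f * derivative a) := rfl

theorem coeff_succ_changeVar (n : ℕ) (a : HurwitzSeries R) :
    coeff (n + 1) (changeVar f a) = coeff n (changeVar f (f * derivative a)) := rfl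

theorem map_changeVar (φ : R →+* S) (a : HurwitzSeries R) :
    map φ (changeVar f a) = changeVar (map φ f) (map φ a) := by
  ext n
  induction n generalizing a with
  | zero => simp
  | succ n ih =>
    rw [coeff_succ_changeVar, ← map_derivative, ← map_mul, ← ih, coeff_map, coeff_succ_changeVar,
      coeff_map]

variable {f}

theorem changeVar_coordinate {w : HurwitzSeries R} (hw : f * derivative w = 1) :
    changeVar f w = algebraMap R _ (coeff 0 w) + X :=
  ext_derivative (by simp) (by simp [derivative_changeVar, hw])

theorem coeff_changeVar_of_forall_lt_eq_zero {m : ℕ} {a : HurwitzSeries R}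
    (ha : ∀ i < m, coeff i a = 0) : coeff m (changeVar f a) = coeff 0 f ^ m * coeff m a := by
  induction m generalizing a with
  | zero => simp
  | succ m ih =>
    have hlt : ∀ i < m, coeff i (derivative a) = 0 := fun i hi => ha (i + 1) (by omega)
    have hlt' : ∀ i < m, coeff i (f * derivative a) = 0 := fun i hi => by
      rw [coeff_mul_of_forall_lt_eq_zero f fun j hj => hlt j (hj.trans hi), hlt i hi, mul_zero]
    rw [coeff_succ_changeVar, ih hlt', coeff_mul_of_forall_lt_eq_zero f hlt, pow_succ, mul_assoc,
      coeff_derivative]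

theorem coeff_eq_zero_of_changeVar [NoZeroDivisors R] (hf : coeff 0 f ≠ 0) {m : ℕ}
    {a : HurwitzSeries R} (ha : ∀ i < m, coeff i (changeVar f a) = 0) :
    ∀ i < m, coeff i a = 0 := by
  intro i
  induction i using Nat.strong_induction_on with
  | _ i ih =>
    intro hi
    have h := ha i hi
    rw [coeff_changeVar_of_forall_lt_eq_zero fun j hj => ih j hj (hj.trans hi)] at h
    exact (mul_eq_zero.mp h).resolve_left (pow_ne_zero i hf)

theorem coeff_eq_sum_changeVar [CharZero K] {f w : HurwitzSeries K} (hw : f * derivative w = 1)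
    (hw₀ : coeff 0 w = 0) (a : HurwitzSeries K) (n : ℕ) :
    coeff n a = ∑ k ∈ range (n + 1),
      coeff k (changeVar f a) / k.factorial * coeff n (w ^ k) := by
  set t : HurwitzSeries K := ∑ k ∈ range (n + 1),
    (coeff k (changeVar f a) / k.factorial) • w ^ k with ht
  have hf : coeff 0 f ≠ 0 := left_ne_zero_of_mul_eq_one <|
    (coeff_zero_mul f (derivative w)).symm.trans (congrArg (coeff 0) hw)
  have hvanish : ∀ i < n + 1, coeff i (changeVar f (a - t)) = 0 := fun i hi => by
    simp only [ht, map_sub, map_sum, map_smul, map_pow, changeVar_coordinate hw, hw₀, map_zero,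
      zero_add, coeff_X_pow, smul_eq_mul, mul_ite, mul_zero]
    rw [sum_ite_eq, if_pos (mem_range.mpr hi),
      div_mul_cancel₀ _ (Nat.cast_ne_zero.mpr i.factorial_ne_zero), sub_self]
  have h := coeff_eq_zero_of_changeVar hf hvanish n n.lt_succ_self
  simpa [ht, sub_eq_zero] using h

end ChangeVar

section CharPChangeVar

variable {p : ℕ} [Fact p.Prime] [CharP K p] {f : HurwitzSeries K}

theorem coeff_prime_changeVar (a : HurwitzSeries K) :
    coeff p (changeVar f a) =
      coeff 1 a * coeff p (changeVar f X) + coeff 0 f ^ p * coeff p a := by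
  have hp : p.Prime := Fact.out
  obtain ⟨q, rfl⟩ := Nat.exists_eq_add_one_of_ne_zero hp.ne_zero
  set y : HurwitzSeries K := mk fun n => coeff (n + 1) a / (n + 1)
  set z := a - algebraMap K _ (coeff 0 a) - X * y with hz
  have halg (n : ℕ) : coeff (n + 1) (algebraMap K (HurwitzSeries K) (coeff 0 a)) = 0 := by
    rw [← coeff_derivative, derivative.map_algebraMap, map_zero]
  have hlt : ∀ i < q + 1, coeff i z = 0 := by
    rintro (_ | i) hi
    · simp [hz]
    · have hi₀ : (i + 1 : K) ≠ 0 := mod_cast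
        (CharP.cast_eq_zero_iff K (q + 1) (i + 1)).not.mpr (Nat.not_dvd_of_pos_of_lt i.succ_pos hi)
      simp [hz, y, coeff_succ_X_mul, halg, mul_div_cancel₀ _ hi₀]
  have hq : (q + 1 : K) = 0 := mod_cast CharP.cast_eq_zero K (q + 1)
  have hz_prime : coeff (q + 1) z = coeff (q + 1) a := by
    simp [hz, coeff_succ_X_mul, halg, hq]
  have ha : a = algebraMap K _ (coeff 0 a) + X * y + z := by rw [hz]; ring
  have hy : coeff 0 y = coeff 1 a := by simp [y]
  conv_lhs => rw [ha]
  simp only [map_add, map_mul, AlgHom.commutes]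
  rw [halg, coeff_prime_mul,
    coeff_changeVar_of_forall_lt_eq_zero hlt, hz_prime]
  simp [hy, mul_comm]

theorem pow_derivativeAlong_mem_truncated {a : HurwitzSeries K} (hf : f ∈ truncated K p)
    (ha : a ∈ truncated K p) (m : ℕ) :
    ((derivativeAlong f).toLinearMap ^ m) a ∈ truncated K p := by
  induction m with
  | zero => exact ha
  | succ m ih =>
    rw [pow_succ', Module.End.mul_apply]
    exact mul_mem hf (derivative_mem_truncated ih)

theorem coeff_add_prime_changeVar {w a : HurwitzSeries K} (hw : f * derivative w = 1)
    (hf : f ∈ truncated K p) (ha : a ∈ truncated K p) (m : ℕ) :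
    coeff (m + p) (changeVar f a) =
      -(coeff 0 f ^ p * coeff p w) * coeff (m + 1) (changeVar f a) := by
  set b := ((derivativeAlong f).toLinearMap ^ m) a
  have hb : coeff p b = 0 := pow_derivativeAlong_mem_truncated hf ha m p le_rfl
  have hone : coeff 0 f * coeff 1 w = 1 := by
    rw [← coeff_derivative, ← coeff_zero_mul, hw, coeff_zero_one]
  have hwp : coeff 1 w * coeff p (changeVar f X) + coeff 0 f ^ p * coeff p w = 0 := by
    rw [← coeff_prime_changeVar, changeVar_coordinate hw, map_add, coeff_X_of_ne_one
      (Fact.out : p.Prime).ne_one, add_zero]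
    exact algebraMap_mem (truncated K p) _ p le_rfl
  have hb₁ : coeff 1 (changeVar f b) = coeff 0 f * coeff 1 b := by
    rw [coeff_succ_changeVar, coeff_zero_changeVar, coeff_zero_mul, coeff_derivative]
  rw [coeff_add_changeVar, coeff_add_changeVar, coeff_prime_changeVar, hb, hb₁]
  linear_combination (-coeff 1 b * coeff p (changeVar f X)) * hone + coeff 0 f * coeff 1 b * hwp

end CharPChangeVar

section PowerSeries

variable [CharZero K]

/-- The exponential generating function `∑ aₙ Xⁿ / n!` as an actual power series. -/
def toPowerSeries : HurwitzSeries K →+* PowerSeries K where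
  toFun a := PowerSeries.mk fun n => coeff n a / n.factorial
  map_one' := by
    ext n
    rcases eq_or_ne n 0 with rfl | hn
    · simp [coeff_one]
    · simp [coeff_one, PowerSeries.coeff_one, hn]
  map_mul' a b := by
    ext n
    rw [PowerSeries.coeff_mk, PowerSeries.coeff_mul, coeff_mul, sum_div]
    refine sum_congr rfl fun ⟨i, j⟩ hij => ?_
    obtain rfl : i + j = n := mem_antidiagonal.mp hij
    have hi : (i.factorial : K) ≠ 0 := Nat.cast_ne_zero.mpr i.factorial_ne_zero
    have hj : (j.factorial : K) ≠ 0 := Nat.cast_ne_zero.mpr j.factorial_ne_zero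
    have hn : ((i + j).factorial : K) ≠ 0 := Nat.cast_ne_zero.mpr (i + j).factorial_ne_zero
    rw [PowerSeries.coeff_mk, PowerSeries.coeff_mk, Nat.cast_add_choose K]
    field_simp
  map_zero' := by ext n; simp
  map_add' a b := by ext n; simp [add_div]

theorem coeff_toPowerSeries (n : ℕ) (a : HurwitzSeries K) :
    PowerSeries.coeff n (toPowerSeries a) = coeff n a / n.factorial :=
  PowerSeries.coeff_mk n fun n => coeff n a / n.factorial

theorem coeff_eq_factorial_mul_coeff_toPowerSeries (n : ℕ) (a : HurwitzSeries K) :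
    coeff n a = n.factorial * PowerSeries.coeff n (toPowerSeries a) := by
  rw [coeff_toPowerSeries, mul_div_cancel₀ _ (Nat.cast_ne_zero.mpr n.factorial_ne_zero)]

end PowerSeries

section Parity

/-- The even series `∑ aₙ X²ⁿ / (2n)!`. -/
def evenSeries (a : ℕ → R) : HurwitzSeries R := mk fun n => if Even n then a (n / 2) else 0

/-- The odd series `∑ aₙ X²ⁿ⁺¹ / (2n+1)!`. -/
def oddSeries (a : ℕ → R) : HurwitzSeries R := mk fun n => if Odd n then a (n / 2) else 0

@[simp] theorem coeff_two_mul_evenSeries (a : ℕ → R) (n : ℕ) :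
    coeff (2 * n) (evenSeries a) = a n := by
  simp [evenSeries]

@[simp] theorem coeff_two_mul_add_one_evenSeries (a : ℕ → R) (n : ℕ) :
    coeff (2 * n + 1) (evenSeries a) = 0 := by
  simp [evenSeries]

@[simp] theorem coeff_two_mul_oddSeries (a : ℕ → R) (n : ℕ) :
    coeff (2 * n) (oddSeries a) = 0 := by
  simp [oddSeries]

@[simp] theorem coeff_two_mul_add_one_oddSeries (a : ℕ → R) (n : ℕ) :
    coeff (2 * n + 1) (oddSeries a) = a n := by
  simp [oddSeries, show (2 * n + 1) / 2 = n by omega]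

theorem map_evenSeries (φ : R →+* S) (a : ℕ → R) :
    map φ (evenSeries a) = evenSeries fun n => φ (a n) := by
  ext n
  simp [evenSeries, apply_ite φ]

theorem evenSeries_mul_evenSeries (a b : ℕ → R) :
    evenSeries a * evenSeries b = evenSeries fun n =>
      ∑ ij ∈ antidiagonal n, (2 * n).choose (2 * ij.1) * (a ij.1 * b ij.2) := by
  ext k
  rw [coeff_mul]
  obtain ⟨n, rfl | rfl⟩ := k.even_or_odd'
  · rw [coeff_two_mul_evenSeries]
    refine (sum_of_injOn (fun ij : ℕ × ℕ => (2 * ij.1, 2 * ij.2)) (fun _ _ _ _ h => by grind)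
      (fun ij hij => ?_) ?_ (by simp)).symm
    · have hsum : ij.1 + ij.2 = n := by simpa using hij
      suffices 2 * ij.1 + 2 * ij.2 = 2 * n by simpa
      omega
    rintro ⟨i, j⟩ hij hrange
    have hsum : i + j = 2 * n := mem_antidiagonal.mp hij
    obtain ⟨m, rfl | rfl⟩ := i.even_or_odd'
    · refine absurd ⟨(m, n - m), ?_, by grind⟩ hrange
      suffices m + (n - m) = n by simpa
      omega
    · rw [coeff_two_mul_add_one_evenSeries, zero_mul, mul_zero]
  · rw [coeff_two_mul_add_one_evenSeries]
    refine sum_eq_zero fun ⟨i, j⟩ hij => ?_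
    have hsum : i + j = 2 * n + 1 := mem_antidiagonal.mp hij
    obtain ⟨m, rfl | rfl⟩ := i.even_or_odd'
    · rw [show j = 2 * (n - m) + 1 by omega, coeff_two_mul_add_one_evenSeries, mul_zero, mul_zero]
    · rw [coeff_two_mul_add_one_evenSeries, zero_mul, mul_zero]

theorem oddSeries_mul_evenSeries (a b : ℕ → R) :
    oddSeries a * evenSeries b = oddSeries fun n =>
      ∑ ij ∈ antidiagonal n, (2 * n + 1).choose (2 * ij.1 + 1) * (a ij.1 * b ij.2) := by
  ext k
  rw [coeff_mul]
  obtain ⟨n, rfl | rfl⟩ := k.even_or_odd'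
  · rw [coeff_two_mul_oddSeries]
    refine sum_eq_zero fun ⟨i, j⟩ hij => ?_
    have hsum : i + j = 2 * n := mem_antidiagonal.mp hij
    obtain ⟨m, rfl | rfl⟩ := i.even_or_odd'
    · rw [coeff_two_mul_oddSeries, zero_mul, mul_zero]
    · rw [show j = 2 * (n - m - 1) + 1 by omega, coeff_two_mul_add_one_evenSeries, mul_zero,
        mul_zero]
  · rw [coeff_two_mul_add_one_oddSeries]
    refine (sum_of_injOn (fun ij : ℕ × ℕ => (2 * ij.1 + 1, 2 * ij.2)) (fun _ _ _ _ h => by grind)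
      (fun ij hij => ?_) ?_ (by simp)).symm
    · have hsum : ij.1 + ij.2 = n := by simpa using hij
      suffices 2 * ij.1 + 1 + 2 * ij.2 = 2 * n + 1 by simpa
      omega
    rintro ⟨i, j⟩ hij hrange
    have hsum : i + j = 2 * n + 1 := mem_antidiagonal.mp hij
    obtain ⟨m, rfl | rfl⟩ := i.even_or_odd'
    · rw [coeff_two_mul_oddSeries, zero_mul, mul_zero]
    · refine absurd ⟨(m, n - m), ?_, by grind⟩ hrange
      suffices m + (n - m) = n by simpa
      omega

end Parity

section Integrality

/-- Differentiating `a²` gives `2 a a'`, so the factor `2` may be cancelled. -/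
theorem coeff_mem_of_coeff_sq [NoZeroDivisors R] {A : Subring R} (h₂ : (2 : R) ≠ 0)
    {a : HurwitzSeries R} (h₀ : coeff 0 a = 1)
    (hsq : ∀ n, ∃ s ∈ A, coeff (n + 1) (a ^ 2) = 2 * s) (n : ℕ) : coeff n a ∈ A := by
  induction n using Nat.strong_induction_on with
  | _ n ih =>
    cases n with
    | zero => exact h₀ ▸ A.one_mem
    | succ n =>
      obtain ⟨s, hs, hsn⟩ := hsq n
      have hmul : coeff n (a * derivative a) = s := by
        refine mul_left_cancel₀ h₂ (hsn ▸ ?_)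
        rw [← coeff_derivative, Derivation.leibniz_pow, map_nsmul]
        simp
      rw [coeff_mul, ← add_sum_erase _ _ (show (0, n) ∈ antidiagonal n by simp)] at hmul
      simp only [Nat.choose_zero_right, Nat.cast_one, one_mul, h₀, coeff_derivative] at hmul
      rw [eq_sub_of_add_eq hmul]
      refine A.sub_mem hs (A.sum_mem fun ⟨i, j⟩ hij => ?_)
      have hsum : i + j = n ∧ i ≠ 0 := by
        obtain ⟨hne, hmem⟩ := mem_erase.mp hij
        have := mem_antidiagonal.mp hmem
        grind
      exact A.mul_mem (natCast_mem A _)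
        (A.mul_mem (ih i (by omega)) (ih (j + 1) (by omega)))

end Integrality

section Hypergeometric

variable {x y : HurwitzSeries R}

theorem hypergeometric_equation
    (hx : ∀ n : ℕ, coeff (n + 2) x = 2 * (2 * n + 1) ^ 2 * coeff n x) :
    (1 - 8 * X ^ 2) * derivative (derivative x) = 16 * X * derivative x + 2 * x := by
  have heuler : derivative (derivative x) =
      8 • (X * derivative (X * derivative x)) + 8 • (X * derivative x) + 2 • x := by
    ext n
    simp only [map_add, map_nsmul, coeff_X_mul_derivative, coeff_derivative, hx]
    ring
  simp only [Derivation.leibniz, derivative_X, smul_eq_mul, nsmul_eq_mul, Nat.cast_ofNat] at heuler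
  linear_combination heuler

theorem wronskian_eq_one
    (hx : ∀ n : ℕ, coeff (n + 2) x = 2 * (2 * n + 1) ^ 2 * coeff n x)
    (hy : ∀ n : ℕ, coeff (n + 2) y = 2 * (2 * n + 1) ^ 2 * coeff n y)
    (hx₀ : coeff 0 x = 0) (hx₁ : coeff 1 x = 1) (hy₀ : coeff 0 y = 1) :
    (1 - 8 * X ^ 2) * (derivative x * y - x * derivative y) = 1 := by
  refine ext_derivative (by simp [hx₀, hx₁, hy₀]) ?_
  have h₈ : derivative (8 : HurwitzSeries R) = 0 := mod_cast derivative.map_natCast 8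
  simp only [Derivation.leibniz, Derivation.leibniz_pow, map_sub, Derivation.map_one_eq_zero, h₈,
    derivative_X, smul_eq_mul, nsmul_eq_mul]
  push_cast
  linear_combination y * hypergeometric_equation hx - x * hypergeometric_equation hy

end Hypergeometric

end

end HurwitzSeries

open HurwitzSeries

noncomputable section

/-- The even solution `∑ 2ⁿ 1² 5² ⋯ (4n-3)² X²ⁿ / (2n)!` of `(1 - 8X²) x'' = 16 X x' + 2 x`. -/
def hypergeometricEven : HurwitzSeries ℤ :=
  evenSeries fun n => 2 ^ n * ∏ i ∈ Finset.range n, (4 * (i : ℤ) + 1) ^ 2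

/-- The odd solution `∑ 2ⁿ 3² 7² ⋯ (4n-1)² X²ⁿ⁺¹ / (2n+1)!` of `(1 - 8X²) x'' = 16 X x' + 2 x`. -/
def hypergeometricOdd : HurwitzSeries ℤ :=
  oddSeries fun n => 2 ^ n * ∏ i ∈ Finset.range n, (4 * (i : ℤ) + 3) ^ 2

/-- The coordinate `w = ∑ 2ⁿ u(n) X²ⁿ⁺¹ / (2n+1)!`, the quotient of the odd solution by the even
one. -/
def romikCoordinate : HurwitzSeries ℤ := oddSeries fun n => 2 ^ n * romikU n

/-- The series `∑ v(n) X²ⁿ / (2n)!`, the square root of the even solution. The `v(n)` are integers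
by `intCast_num_romikV`, so taking numerators does not change them. -/
def romikSeries : HurwitzSeries ℤ := evenSeries fun n => (romikV n).num

/-- The derivative `dX/dw` with respect to the coordinate `w = romikCoordinate`. -/
def romikField : HurwitzSeries ℤ := (1 - 8 * X ^ 2) * romikSeries ^ 4

theorem coeff_add_two_hypergeometricEven (n : ℕ) : coeff (n + 2) hypergeometricEven =
    2 * (2 * n + 1) ^ 2 * coeff n hypergeometricEven := by
  obtain ⟨m, rfl | rfl⟩ := n.even_or_odd'
  · rw [hypergeometricEven, ← mul_add_one 2 m, coeff_two_mul_evenSeries, coeff_two_mul_evenSeries,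
      Finset.prod_range_succ]
    push_cast
    ring
  · rw [hypergeometricEven, add_right_comm, ← mul_add_one 2 m, coeff_two_mul_add_one_evenSeries,
      coeff_two_mul_add_one_evenSeries, mul_zero]

theorem coeff_add_two_hypergeometricOdd (n : ℕ) : coeff (n + 2) hypergeometricOdd =
    2 * (2 * n + 1) ^ 2 * coeff n hypergeometricOdd := by
  obtain ⟨m, rfl | rfl⟩ := n.even_or_odd'
  · rw [hypergeometricOdd, ← mul_add_one 2 m, coeff_two_mul_oddSeries, coeff_two_mul_oddSeries,
      mul_zero]
  · rw [hypergeometricOdd, add_right_comm, ← mul_add_one 2 m, coeff_two_mul_add_one_oddSeries,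
      coeff_two_mul_add_one_oddSeries, Finset.prod_range_succ]
    push_cast
    ring

theorem coeff_zero_hypergeometricEven : coeff 0 hypergeometricEven = 1 :=
  coeff_two_mul_evenSeries _ 0

theorem romikCoordinate_mul_hypergeometricEven :
    romikCoordinate * hypergeometricEven = hypergeometricOdd := by
  rw [romikCoordinate, hypergeometricEven, oddSeries_mul_evenSeries, hypergeometricOdd]
  congr 1
  funext n
  rw [Finset.Nat.sum_antidiagonal_eq_sum_range_succ_mk, Finset.sum_range_succ, romikU_eq n,
    mul_sub, Finset.mul_sum]
  have hterm : ∀ m ∈ Finset.range n, ((2 * n + 1).choose (2 * m + 1) : ℤ) * (2 ^ m * romikU m *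
      (2 ^ (n - m) * ∏ i ∈ Finset.range (n - m), (4 * (i : ℤ) + 1) ^ 2)) =
      2 ^ n * (((2 * n + 1).choose (2 * m + 1) : ℤ) *
        (∏ i ∈ Finset.range (n - m), (4 * (i : ℤ) + 1) ^ 2) * romikU m) := fun m hm => by
    rw [← pow_mul_pow_sub 2 (Finset.mem_range.mp hm).le]
    ring
  rw [Finset.sum_congr rfl hterm]
  simp

theorem evenSeries_romikV_sq :
    evenSeries romikV ^ 2 = map (Int.castRingHom ℚ) hypergeometricEven := by
  rw [sq, evenSeries_mul_evenSeries, hypergeometricEven, map_evenSeries]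
  congr 1
  funext n
  rcases Nat.eq_zero_or_pos n with rfl | hn
  · simp [romikV_zero]
  have hends : ∑ ij ∈ Finset.HasAntidiagonal.antidiagonal n,
        ((2 * n).choose (2 * ij.1) : ℚ) * (romikV ij.1 * romikV ij.2) = 2 * romikV n +
      ∑ m ∈ Finset.Ico 1 n, ((2 * n).choose (2 * m) : ℚ) * romikV m * romikV (n - m) := by
    rw [Finset.Nat.sum_antidiagonal_eq_sum_range_succ_mk, Finset.sum_range_succ,
      Finset.range_eq_Ico, Finset.sum_eq_sum_Ico_succ_bot hn, two_mul (romikV n)]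
    simp only [mul_zero, Nat.choose_zero_right, Nat.cast_one, romikV_zero, one_mul, Nat.sub_zero,
      Nat.choose_self, Nat.sub_self, mul_one, zero_add, mul_assoc]
    ring
  rw [hends, romikV_eq n hn, ← mul_pow_sub_one hn.ne' (2 : ℤ), eq_intCast]
  push_cast
  ring

theorem two_dvd_coeff_succ_hypergeometricEven (n : ℕ) :
    (2 : ℤ) ∣ coeff (n + 1) hypergeometricEven := by
  obtain ⟨m, hm | hm⟩ := (n + 1).even_or_odd'
  · rw [hm, hypergeometricEven, coeff_two_mul_evenSeries]
    exact (dvd_pow_self 2 (by omega)).mul_right _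
  · rw [hm, hypergeometricEven, coeff_two_mul_add_one_evenSeries]
    exact dvd_zero 2

theorem intCast_num_romikV (n : ℕ) : ((romikV n).num : ℚ) = romikV n := by
  have hsq (n : ℕ) :
      ∃ s ∈ (Int.castRingHom ℚ).range, coeff (n + 1) (evenSeries romikV ^ 2) = 2 * s := by
    obtain ⟨c, hc⟩ := two_dvd_coeff_succ_hypergeometricEven n
    exact ⟨c, ⟨c, rfl⟩, by simp [evenSeries_romikV_sq, hc]⟩
  obtain ⟨v, hv⟩ := coeff_mem_of_coeff_sq two_ne_zero
    ((coeff_two_mul_evenSeries romikV 0).trans romikV_zero) hsq (2 * n)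
  rw [coeff_two_mul_evenSeries, eq_intCast] at hv
  rw [← hv, Rat.num_intCast]

theorem map_romikSeries : map (Int.castRingHom ℚ) romikSeries = evenSeries romikV := by
  rw [romikSeries, map_evenSeries]
  exact congrArg evenSeries (funext intCast_num_romikV)

theorem romikSeries_sq : romikSeries ^ 2 = hypergeometricEven :=
  map_injective (φ := Int.castRingHom ℚ) Int.cast_injective <| by
    rw [map_pow, map_romikSeries, evenSeries_romikV_sq]

theorem coeff_zero_romikSeries : coeff 0 romikSeries = 1 := by
  refine (coeff_two_mul_evenSeries _ 0).trans ?_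
  rw [romikV_zero, Rat.num_one]

theorem coeff_zero_romikField : coeff 0 romikField = 1 := by
  simp [romikField, coeff_zero_romikSeries]

theorem coeff_zero_romikCoordinate : coeff 0 romikCoordinate = 0 :=
  coeff_two_mul_oddSeries _ 0

theorem romikField_mul_derivative_romikCoordinate :
    romikField * derivative romikCoordinate = 1 := by
  have hw := wronskian_eq_one coeff_add_two_hypergeometricOdd coeff_add_two_hypergeometricEven
    (coeff_two_mul_oddSeries _ 0) ((coeff_two_mul_add_one_oddSeries _ 0).trans (by simp))
    coeff_zero_hypergeometricEven
  rw [← romikCoordinate_mul_hypergeometricEven, Derivation.leibniz, smul_eq_mul, smul_eq_mul] at hw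
  rw [romikField, show romikSeries ^ 4 = hypergeometricEven ^ 2 by rw [← romikSeries_sq]; ring]
  linear_combination hw

theorem map_romikField_mul_derivative {R : Type*} [CommRing R] (φ : ℤ →+* R) :
    map φ romikField * derivative (map φ romikCoordinate) = 1 := by
  rw [← map_derivative, ← map_mul, romikField_mul_derivative_romikCoordinate, map_one]

/-- The integer `d(n)`, obtained by expanding `romikSeries` in the coordinate `romikCoordinate`. -/
def romikDInt (n : ℕ) : ℤ := coeff (2 * n) (changeVar romikField romikSeries)

section Expansion

theorem coeff_X_mul_expand_two_pow {R : Type*} [CommRing R] (g : PowerSeries R) (j k : ℕ) :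
    PowerSeries.coeff (2 * j + k) ((PowerSeries.X * PowerSeries.expand 2 two_ne_zero g) ^ k) =
      PowerSeries.coeff j (g ^ k) := by
  rw [mul_pow, PowerSeries.coeff_X_pow_mul, ← map_pow, PowerSeries.coeff_expand_mul]

theorem coeff_two_mul_X_mul_expand_two_pow_of_odd {R : Type*} [CommRing R] (g : PowerSeries R)
    (n : ℕ) {k : ℕ} (hk : Odd k) :
    PowerSeries.coeff (2 * n) ((PowerSeries.X * PowerSeries.expand 2 two_ne_zero g) ^ k) = 0 := by
  rw [mul_pow, PowerSeries.coeff_X_pow_mul', ← map_pow]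
  split_ifs with h
  · exact PowerSeries.coeff_expand_of_not_dvd 2 _ _ (by grind)
  · rfl

/-- The power series `g` with `∑ u(j) / (2j+1)! z^(2j+1) = z g(z²)`. -/
def romikUCore : PowerSeries ℚ := PowerSeries.mk fun j => romikU j / (2 * j + 1).factorial

theorem romikUSeries_eq_X_mul_expand :
    romikUSeries = PowerSeries.X * PowerSeries.expand 2 two_ne_zero romikUCore := by
  ext n
  cases n with
  | zero => simp [romikUSeries]
  | succ n =>
    rw [PowerSeries.coeff_succ_X_mul, romikUSeries, PowerSeries.coeff_mk]
    obtain ⟨j, rfl | rfl⟩ := n.even_or_odd'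
    · rw [PowerSeries.coeff_expand_mul, romikUCore, PowerSeries.coeff_mk, if_pos (by omega),
        show (2 * j + 1) / 2 = j by omega]
    · rw [PowerSeries.coeff_expand_of_not_dvd _ _ _ (by omega), if_neg (by omega)]

theorem toPowerSeries_romikCoordinate_eq_X_mul_expand :
    (map (Int.castRingHom ℚ) romikCoordinate).toPowerSeries =
      PowerSeries.X * PowerSeries.expand 2 two_ne_zero (PowerSeries.rescale 2 romikUCore) := by
  ext n
  rw [coeff_toPowerSeries, coeff_map, romikCoordinate]
  cases n with
  | zero => simp [oddSeries]
  | succ n =>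
    rw [PowerSeries.coeff_succ_X_mul]
    obtain ⟨j, rfl | rfl⟩ := n.even_or_odd'
    · rw [PowerSeries.coeff_expand_mul, PowerSeries.coeff_rescale, romikUCore, PowerSeries.coeff_mk,
        coeff_two_mul_add_one_oddSeries, map_mul, map_pow, mul_div_assoc]
      rfl
    · rw [PowerSeries.coeff_expand_of_not_dvd _ _ _ (by omega), add_assoc, ← mul_add_one 2 j,
        coeff_two_mul_oddSeries, map_zero, zero_div]

theorem romikS_self (n : ℕ) : romikS n n = 1 := by
  have hcore : PowerSeries.constantCoeff romikUCore = 1 := by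
    rw [← PowerSeries.coeff_zero_eq_constantCoeff_apply, romikUCore, PowerSeries.coeff_mk,
      romikU_eq]
    simp
  have hcoeff : PowerSeries.coeff (2 * n) (romikUSeries ^ (2 * n)) = 1 := by
    have h := coeff_X_mul_expand_two_pow romikUCore 0 (2 * n)
    rw [mul_zero, zero_add] at h
    rw [romikUSeries_eq_X_mul_expand, h]
    simp [hcore]
  rw [romikS, hcoeff, mul_one, div_self (Nat.cast_ne_zero.mpr (Nat.factorial_ne_zero _))]

theorem romikS_zero_right {n : ℕ} (hn : 1 ≤ n) : romikS n 0 = 0 := by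
  rw [romikS, mul_zero, pow_zero, PowerSeries.coeff_one, if_neg (by omega), mul_zero]

theorem coeff_two_mul_romikCoordinate_pow_of_odd (n : ℕ) {k : ℕ} (hk : Odd k) :
    coeff (2 * n) (map (Int.castRingHom ℚ) romikCoordinate ^ k) = 0 := by
  rw [coeff_eq_factorial_mul_coeff_toPowerSeries, map_pow,
    toPowerSeries_romikCoordinate_eq_X_mul_expand,
    coeff_two_mul_X_mul_expand_two_pow_of_odd _ n hk, mul_zero]

theorem coeff_two_mul_romikCoordinate_pow {n k : ℕ} (hk : k ≤ n) :
    coeff (2 * n) (map (Int.castRingHom ℚ) romikCoordinate ^ (2 * k)) =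
      (2 * k).factorial * (2 ^ (n - k) * romikS n k) := by
  obtain ⟨j, rfl⟩ := Nat.exists_eq_add_of_le' hk
  have hfac : ((2 * k).factorial : ℚ) ≠ 0 := Nat.cast_ne_zero.mpr (Nat.factorial_ne_zero _)
  rw [coeff_eq_factorial_mul_coeff_toPowerSeries, map_pow, romikS,
    toPowerSeries_romikCoordinate_eq_X_mul_expand, romikUSeries_eq_X_mul_expand, mul_add,
    coeff_X_mul_expand_two_pow, coeff_X_mul_expand_two_pow, ← map_pow, PowerSeries.coeff_rescale,
    Nat.add_sub_cancel]
  field_simp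

theorem romikV_eq_sum (n : ℕ) : romikV n =
    ∑ k ∈ Finset.range (n + 1), 2 ^ (n - k) * romikS n k * romikDInt k := by
  have htaylor := coeff_eq_sum_changeVar (map_romikField_mul_derivative (Int.castRingHom ℚ))
    (by simp [coeff_zero_romikCoordinate]) (map (Int.castRingHom ℚ) romikSeries) (2 * n)
  rw [← map_changeVar, map_romikSeries, coeff_two_mul_evenSeries] at htaylor
  rw [htaylor]
  refine (Finset.sum_of_injOn (2 * ·) (fun _ _ _ _ h => by grind)
    (fun k hk => ?_) (fun k hk hrange => ?_) fun k hk => ?_).symm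
  · have hk_lt : k < n + 1 := Finset.mem_range.mp hk
    suffices 2 * k < 2 * n + 1 by simpa
    omega
  · have hodd : Odd k := by
      by_contra heven
      obtain ⟨j, rfl⟩ := even_iff_exists_two_mul.mp (Nat.not_odd_iff_even.mp heven)
      have hj : 2 * j < 2 * n + 1 := Finset.mem_range.mp hk
      exact hrange ⟨j, Finset.mem_coe.mpr (Finset.mem_range.mpr (by omega)), rfl⟩
    rw [coeff_two_mul_romikCoordinate_pow_of_odd n hodd, mul_zero]
  · have hfac : ((2 * k).factorial : ℚ) ≠ 0 := Nat.cast_ne_zero.mpr (Nat.factorial_ne_zero _)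
    rw [coeff_two_mul_romikCoordinate_pow (Finset.mem_range_succ_iff.mp hk), coeff_map, romikDInt,
      eq_intCast]
    field_simp

theorem intCast_romikDInt (n : ℕ) : (romikDInt n : ℚ) = romikD n := by
  induction n using Nat.strong_induction_on with
  | _ n ih =>
    rw [romikD_eq, romikV_eq_sum, Finset.sum_range_succ, romikS_self, Nat.sub_self, pow_zero,
      one_mul, one_mul]
    rcases Nat.eq_zero_or_pos n with rfl | hn
    · simp
    have hsum : ∑ k ∈ Finset.range n, 2 ^ (n - k) * romikS n k * romikDInt k =
        ∑ k ∈ Finset.Ico 1 n, 2 ^ (n - k) * romikS n k * romikD k := by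
      rw [Finset.range_eq_Ico, Finset.sum_eq_sum_Ico_succ_bot hn, romikS_zero_right hn, mul_zero,
        zero_mul, zero_add]
      exact Finset.sum_congr rfl fun k hk => by rw [ih k (Finset.mem_Ico.mp hk).2]
    rw [hsum, add_sub_cancel_left]

end Expansion

section ModPrime

variable {p : ℕ} [Fact p.Prime]

theorem map_hypergeometricEven_mem_truncated (hp : p ≡ 1 [MOD 4]) :
    map (Int.castRingHom (ZMod p)) hypergeometricEven ∈ truncated (ZMod p) p := by
  intro n hn
  have hp₄ : p % 4 = 1 := hp
  rw [hypergeometricEven, map_evenSeries]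
  obtain ⟨m, rfl | rfl⟩ := n.even_or_odd'
  · have hroot : Int.castRingHom (ZMod p) (4 * ((p / 4 : ℕ) : ℤ) + 1) = 0 := by
      rw [eq_intCast, ← ZMod.natCast_self p]
      exact_mod_cast congrArg Nat.cast (show 4 * (p / 4) + 1 = p by omega)
    rw [coeff_two_mul_evenSeries, map_mul, map_prod,
      Finset.prod_eq_zero (Finset.mem_range.mpr (show p / 4 < m by omega))
        (by rw [map_pow, hroot, zero_pow two_ne_zero]), mul_zero]
  · rw [coeff_two_mul_add_one_evenSeries]

theorem map_romikSeries_mem_truncated (hp : p ≡ 1 [MOD 4]) :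
    map (Int.castRingHom (ZMod p)) romikSeries ∈ truncated (ZMod p) p := by
  set v := map (Int.castRingHom (ZMod p)) romikSeries
  have hp₄ : p % 4 = 1 := hp
  have hpow : v ^ p = 1 := by
    rw [pow_char, coeff_map, coeff_zero_romikSeries, map_one, one_pow, map_one]
  have hv : v = (v ^ 2) ^ ((p + 1) / 2) := by
    rw [← pow_mul, Nat.mul_div_cancel' (by omega), pow_succ, hpow, one_mul]
  rw [hv, ← map_pow, romikSeries_sq]
  exact pow_mem (map_hypergeometricEven_mem_truncated hp) _

theorem map_romikField_mem_truncated (hp : p ≡ 1 [MOD 4]) :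
    map (Int.castRingHom (ZMod p)) romikField ∈ truncated (ZMod p) p := by
  rw [romikField, map_mul, map_sub, map_mul, map_one, map_pow, map_pow, map_X, map_ofNat]
  exact mul_mem (sub_mem (one_mem _) (mul_mem (ofNat_mem _ 8) (pow_mem X_mem_truncated 2)))
    (pow_mem (map_romikSeries_mem_truncated hp) 4)

theorem coeff_prime_hypergeometricOdd_ne_zero (hp : p ≡ 1 [MOD 4]) :
    Int.castRingHom (ZMod p) (coeff p hypergeometricOdd) ≠ 0 := by
  have hp₄ : p % 4 = 1 := hp
  have hcoeff : coeff p hypergeometricOdd =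
      2 ^ (p / 2) * ∏ i ∈ Finset.range (p / 2), (4 * (i : ℤ) + 3) ^ 2 := by
    conv_lhs => rw [show p = 2 * (p / 2) + 1 by omega]
    rw [hypergeometricOdd, coeff_two_mul_add_one_oddSeries]
  have hne (m : ℕ) (hm : ¬ p ∣ m) : Int.castRingHom (ZMod p) m ≠ 0 := by
    rwa [map_natCast, Ne, ZMod.natCast_eq_zero_iff]
  have htwo : ¬ p ∣ 2 := fun h => by
    have := Nat.le_of_dvd two_pos h
    have := (Fact.out : p.Prime).two_le
    omega
  rw [hcoeff, map_mul, map_pow, map_prod]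
  refine mul_ne_zero (pow_ne_zero _ (hne 2 htwo)) (Finset.prod_ne_zero_iff.mpr fun i hi => ?_)
  have hi_lt : i < p / 2 := Finset.mem_range.mp hi
  have hdvd : ¬ p ∣ 4 * i + 3 := by
    rintro ⟨k, hk⟩
    have hk_lt : k < 2 := by
      by_contra! hk_ge
      have := Nat.mul_le_mul_left p hk_ge
      omega
    interval_cases k <;> omega
  rw [map_pow]
  exact pow_ne_zero 2 (mod_cast hne (4 * i + 3) hdvd)

theorem coeff_prime_romikCoordinate_ne_zero (hp : p ≡ 1 [MOD 4]) :
    coeff p (map (Int.castRingHom (ZMod p)) romikCoordinate) ≠ 0 := by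
  have heq : coeff p (map (Int.castRingHom (ZMod p)) hypergeometricOdd) =
      coeff p (map (Int.castRingHom (ZMod p)) romikCoordinate) := by
    rw [← romikCoordinate_mul_hypergeometricEven, map_mul, coeff_prime_mul]
    simp [coeff_zero_hypergeometricEven, coeff_zero_romikCoordinate]
  exact heq ▸ coeff_prime_hypergeometricOdd_ne_zero hp

theorem romikDInt_add_half_prime (hp : p ≡ 1 [MOD 4]) {n : ℕ} (hn : 1 ≤ n) :
    (romikDInt (n + (p - 1) / 2) : ZMod p) =
      -coeff p (map (Int.castRingHom (ZMod p)) romikCoordinate) * romikDInt n := by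
  have hp₄ : p % 4 = 1 := hp
  have h := coeff_add_prime_changeVar (map_romikField_mul_derivative (Int.castRingHom (ZMod p)))
    (map_romikField_mem_truncated hp) (map_romikSeries_mem_truncated hp) (2 * n - 1)
  rw [← map_changeVar, show 2 * n - 1 + p = 2 * (n + (p - 1) / 2) by omega,
    Nat.sub_add_cancel (by omega), coeff_map _ 0 romikField, coeff_zero_romikField, map_one,
    one_pow, one_mul] at h
  exact h

theorem romikDInt_add_mul_half_prime (hp : p ≡ 1 [MOD 4]) {n : ℕ} (hn : 1 ≤ n) (k : ℕ) :
    (romikDInt (n + k * ((p - 1) / 2)) : ZMod p) =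
      (-coeff p (map (Int.castRingHom (ZMod p)) romikCoordinate)) ^ k * romikDInt n := by
  induction k with
  | zero => simp
  | succ k ih =>
    rw [add_one_mul, ← add_assoc, romikDInt_add_half_prime hp (by omega), ih, pow_succ', mul_assoc]

end ModPrime

end

theorem mainTheorem2 :
    ∃ d : ℕ → ℤ, (∀ n : ℕ, (d n : ℚ) = romikD n) ∧
      ∀ p : ℕ, p.Prime → p ≡ 1 [MOD 4] →
        ∀ n : ℕ, 1 ≤ n → d (n + (p - 1) ^ 2 / 2) ≡ d n [ZMOD (p : ℤ)] := by
  refine ⟨romikDInt, intCast_romikDInt, fun p hp hp₄ n hn => ?_⟩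
  have : Fact p.Prime := ⟨hp⟩
  have hperiod : (p - 1) ^ 2 / 2 = (p - 1) * ((p - 1) / 2) := by
    have hmod : p % 4 = 1 := hp₄
    rw [sq, Nat.mul_div_assoc _ (by omega)]
  have hfermat := ZMod.pow_card_sub_one_eq_one
    (neg_ne_zero.mpr (coeff_prime_romikCoordinate_ne_zero hp₄))
  rw [← ZMod.intCast_eq_intCast_iff, hperiod, romikDInt_add_mul_half_prime hp₄ hn, hfermat,
    one_mul]
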